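/- Let $N\ge 3$ be an integer and let $k$ be a field with $\operatorname{char}k=0$ or $\operatorname{char}k>N$. Let $z_1,\dots,z_N,t,a_0$ be indeterminates, let $e_i$ ($1\le i\le N$) be the $i$-th elementary symmetric polynomial in $z_1,\dots,z_N$, and let $E_i(t)$ be the $i$-th elementary symmetric polynomial in $z_1+t,\dots,z_N+t$. Put $a_i:=a_0e_i$ for $1\le i\le N$, so that $a_0,\dots,a_N$ are the (algebraically independent) coefficients of the generic binary form of degree $N$. A semi-invariant of degree $d$ and weight $w$ of this form is a polynomial $Q\in k[a_0,\dots,a_N]$ of the form $Q=a_0^{d}\,P(e_1,\dots,e_N)$, where the polynomial $P$ over $k$ has total degree at most $d$ in $e_1,\dots,e_N$, is translation invariant, i.e. $P(E_1(t),\dots,E_N(t))=P(e_1,\dots,e_N)$, and $P(e_1,\dots,e_N)$ is homogeneous of degree $w$ as a polynomial in $z_1,\dots,z_N$. Let $\beta(N)=\lfloor(\sqrt{8N+1}-1)/2\rfloor$, let $s$ be an integer with $1\le s\le\beta(N)-1$, and let $\mathfrak a=(m_1<\dots<m_{s+1})$ be a partition of $N$ into $s+1$ distinct positive parts. Put $\operatorname{wt}(N,\mathfrak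 a)=\tfrac12\bigl(N^2-\sum_i m_i^2\bigr)$. Let $w$ be an integer such that $\theta:=w-\operatorname{wt}(N,\mathfrak a)\ge 1$, and put \[ d(w,\mathfrak a)=\begin{cases}N-1+\theta & \text{if } m_1=1 \text{ or } \theta=1,\\ N-m_1+1+\lceil\theta/m_1\rceil&\text{otherwise.}\end{cases}\] Then for every integer $d\ge d(w,\mathfrak a)$ there are (at least) $\binom{s-1+\theta}{s-1}$ $k$-linearly independent semi-invariants of weight $w$ and degree $d$ of the generic binary form of degree $N$. Consequently (from the case of characteristic $0$), for all such $N,s,\mathfrak a,w,d$, the coefficient of $q^w$ in $(1-q)\binom{N+d}{d}_q$ is at least $\binom{s-1+\theta}{s-1}$, where $\binom{N+d}{d}_q$ is the $q$-binomial coefficient. -/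

import Mathlib

noncomputable section

namespace BinaryForm

open Finset

/-! ### Partitions into distinct parts and the numerical data attached to them -/

/-- `(m 0 < m 1 < ... < m s)` is a partition of `n` into `s + 1` distinct positive parts. -/
def IsDistinctPartition (n s : ℕ) (m : Fin (s + 1) → ℕ) : Prop :=
  StrictMono m ∧ 1 ≤ m 0 ∧ ∑ i, m i = n

/-- `wt(n, m) = (n ^ 2 - ∑ (m i) ^ 2) / 2`. For `n = ∑ m i` neither the subtraction nor the
division truncates, see `two_mul_wt_add`. -/
def wt (n : ℕ) {r : ℕ} (m : Fin r → ℕ) : ℕ :=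
  (n ^ 2 - ∑ i, (m i) ^ 2) / 2

theorem two_mul_wt_add {n r : ℕ} (m : Fin r → ℕ) (h : ∑ i, m i = n) :
    2 * wt n m + ∑ i, (m i) ^ 2 = n ^ 2 := by
  have key : ∃ c, n ^ 2 = 2 * c + ∑ i, (m i) ^ 2 := by
    subst h
    induction r with
    | zero => exact ⟨0, by simp⟩
    | succ r ih =>
      obtain ⟨c, hc⟩ := ih (fun i => m i.succ)
      refine ⟨c + m 0 * ∑ i : Fin r, m i.succ, ?_⟩
      rw [Fin.sum_univ_succ, Fin.sum_univ_succ]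
      linear_combination hc
  obtain ⟨c, hc⟩ := key
  unfold wt
  omega

/-- `β(n) = ⌊(√(8 n + 1) - 1) / 2⌋`. -/
def beta (n : ℕ) : ℕ := ⌊(Real.sqrt (8 * n + 1) - 1) / 2⌋₊

/-- The degree bound `d(w, m)`. It is used only for partitions `m` of `n` into distinct positive
parts and for `w ≥ 1 + wt(n, m)`, where none of the subtractions truncates. -/
def degBound (n : ℕ) {s : ℕ} (w : ℕ) (m : Fin (s + 1) → ℕ) : ℕ :=
  if m 0 = 1 ∨ w = 1 + wt n m then n - 1 + (w - wt n m)
  else n - m 0 + 1 + ⌈((w - wt n m : ℕ) : ℚ) / (m 0 : ℚ)⌉₊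

/-- The number `ν(w, m) = binom(s - 1 + w - wt(n, m), s - 1)`, where `m` has `s + 1` parts. -/
def nu (n : ℕ) {s : ℕ} (w : ℕ) (m : Fin (s + 1) → ℕ) : ℕ :=
  (s - 1 + (w - wt n m)).choose (s - 1)

/-! ### Semi-invariants of the generic binary form of degree `N` -/

section SemiInvariants

variable (N : ℕ) (k : Type*) [Field k]

/-- `e_{i+1}`, the elementary symmetric polynomial of degree `i + 1` in `z_1, ..., z_N`. -/
def elem (i : Fin N) : MvPolynomial (Fin N) k :=
  MvPolynomial.esymm (Fin N) k (i + 1)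

/-- `E_{i+1}(t)`, the elementary symmetric polynomial of degree `i + 1` in
`z_1 + t, ..., z_N + t`, an element of `k[z_1, ..., z_N][t]`. -/
def shiftedElem (i : Fin N) : Polynomial (MvPolynomial (Fin N) k) :=
  MvPolynomial.aeval (fun j : Fin N => Polynomial.C (MvPolynomial.X j) + Polynomial.X)
    (MvPolynomial.esymm (Fin N) k (i + 1))

/-- The coefficients `a_0` and `a_i = a_0 e_i` (`1 ≤ i ≤ N`) of the generic binary form, as
elements of `k[z_1, ..., z_N][a_0]`. -/
def formCoeff : Fin (N + 1) → Polynomial (MvPolynomial (Fin N) k) :=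
  Fin.cons Polynomial.X (fun i : Fin N => Polynomial.X * Polynomial.C (elem N k i))

variable {N k}

/-- `P(E_1(t), ..., E_N(t)) = P(e_1, ..., e_N)`. -/
def IsTranslationInvariant (P : MvPolynomial (Fin N) k) : Prop :=
  MvPolynomial.aeval (shiftedElem N k) P = Polynomial.C (MvPolynomial.aeval (elem N k) P)

/-- A polynomial `Q` in `a_0, ..., a_N` is a semi-invariant of degree `d` and weight `w` if
`Q = a_0 ^ d P(e_1, ..., e_N)`, where `P` is translation invariant, homogeneous of degree `w` as a
polynomial in `z_1, ..., z_N`, and of total degree at most `d` in `e_1, ..., e_N`. -/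
def IsSemiInvariant (d w : ℕ) (Q : MvPolynomial (Fin (N + 1)) k) : Prop :=
  ∃ P : MvPolynomial (Fin N) k,
    IsTranslationInvariant P ∧
    (MvPolynomial.aeval (elem N k) P).IsHomogeneous w ∧
    P.totalDegree ≤ d ∧
    MvPolynomial.aeval (formCoeff N k) Q =
      Polynomial.X ^ d * Polynomial.C (MvPolynomial.aeval (elem N k) P)

end SemiInvariants

/-! ### Gaussian binomial coefficients -/

/-- The `q`-binomial coefficient `binom(n, r)_q`, a polynomial in `q = X`, through the `q`-Pascal
rule; see `qBinom_mul_prod` for the product formula. -/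
def qBinom : ℕ → ℕ → Polynomial ℤ
  | _, 0 => 1
  | 0, _ + 1 => 0
  | n + 1, r + 1 => qBinom n r + Polynomial.X ^ (r + 1) * qBinom n (r + 1)

theorem qBinom_eq_zero : ∀ {n r : ℕ}, n < r → qBinom n r = 0
  | _, 0, h => absurd h (Nat.not_lt_zero _)
  | 0, _ + 1, _ => by simp [qBinom]
  | n + 1, r + 1, h => by
    rw [qBinom, qBinom_eq_zero (by omega), qBinom_eq_zero (by omega)]; simp

/-- `binom(m + r, r)_q * ∏ (1 - q ^ i) = ∏ (1 - q ^ (m + i))`, products over `1 ≤ i ≤ r`. -/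
theorem qBinom_mul_prod (m r : ℕ) :
    qBinom (m + r) r * ∏ i ∈ range r, (1 - Polynomial.X ^ (i + 1)) =
      ∏ i ∈ range r, (1 - Polynomial.X ^ (m + i + 1)) := by
  induction r generalizing m with
  | zero => simp [qBinom]
  | succ r ih =>
    induction m with
    | zero =>
      have h := ih 0
      simp only [zero_add] at h ⊢
      rw [qBinom, qBinom_eq_zero (Nat.lt_succ_self r), prod_range_succ, mul_zero, add_zero,
        ← mul_assoc, h]
    | succ m ihm =>
      have h1 := ih (m + 1)
      have e1 : m + 1 + (r + 1) = (m + 1 + r) + 1 := by ring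
      have e2 : m + (r + 1) = m + 1 + r := by ring
      rw [e2] at ihm
      have e3 : ∏ i ∈ range (r + 1), (1 - Polynomial.X ^ (m + i + 1) : Polynomial ℤ) =
          (∏ i ∈ range r, (1 - Polynomial.X ^ (m + 1 + i + 1))) * (1 - Polynomial.X ^ (m + 1)) := by
        rw [prod_range_succ']
        congr 1
        exact prod_congr rfl fun i _ => by congr 2; ring
      rw [e3] at ihm
      rw [e1, qBinom, add_mul, mul_assoc, ihm, prod_range_succ, ← mul_assoc, h1, prod_range_succ]
      ring

end BinaryForm

end

noncomputable section

namespace BinaryForm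

open Finset MvPolynomial

set_option linter.unusedSectionVars false


/-! ### From symmetric polynomials in the roots to semi-invariants. -/

section Elementary

open AddMonoidAlgebra

variable {N : ℕ} {k : Type*} [Field k]

/-! A semi-invariant of degree `d` and weight `w` comes from a symmetric, translation-invariant,
homogeneous polynomial of degree `w` in the roots, of degree at most `d` in each root. To build such
polynomials, split the roots into blocks of sizes `m b`. The product of all differences across
blocks has degree `wt N m`. Multiply it by `θ` further differences between a root of a chosen block
and a root of the smallest block, and symmetrize.

Independence is seen by setting all the roots of a block equal (`aeval_symmetrize_crossProd_mul`).
As the block sizes are distinct, only the permutations preserving each block survive. With the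
smallest block sent to 0, the results are one fixed nonzero polynomial times the monomials of degree
`θ` in `s` variables, which gives the binomial count. Cycling through the roots of each block keeps
the individual degrees low.

For the `q`-binomial coefficient, replacing each monomial `z^a` by `∏ X (a i)` embeds these
polynomials, over `ℚ`, in the kernel of the lowering operator of `sl₂` on forms of degree `N` in `X
0, ..., X d`. For `2 * w ≤ d * N` lowering from weight `w` is surjective
(`card_add_finrank_boxSpace_le`), so its kernel has as dimension the difference of two numbers of
partitions in a box. That difference is the required coefficient (`coeff_one_sub_X_mul_qBinom`). -/

theorem totalDegree_le_of_degreeOf_esymm_le (d : ℕ) (P : MvPolynomial (Fin N) k)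
    (h : ∀ i, (aeval (elem N k) P).degreeOf i ≤ d) : P.totalDegree ≤ d := by
  classical
  rcases eq_or_ne P 0 with rfl | hP
  · simp
  rcases N with _ | n
  · rw [totalDegree_eq_zero_iff_eq_C.2 (eq_C_of_isEmpty P)]
    exact Nat.zero_le d
  set acc := Fin.accumulate (n + 1) (n + 1)
  have hinj : Function.Injective (fun t : Fin (n + 1) →₀ ℕ =>
      toLex (Finsupp.equivFunOnFinite.symm (acc t))) := fun t u htu =>
    DFunLike.coe_injective (Fin.accumulate_injective le_rfl
      (Finsupp.equivFunOnFinite.symm.injective (toLex.injective htu)))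
  have hsup : ∀ t ∈ P.support, (esymmAlgHomMonomial (Fin (n + 1)) t (coeff t P)).supDegree toLex =
      toLex (Finsupp.equivFunOnFinite.symm (acc t)) := fun t ht => by
    rw [← ofLex_inj, DFunLike.ext'_iff, supDegree_esymmAlgHomMonomial (mem_support_iff.1 ht) t le_rfl]
    rfl
  obtain ⟨t, ht, hmax⟩ := P.support.exists_max_image
    (fun t => toLex (Finsupp.equivFunOnFinite.symm (acc t))) (support_nonempty.2 hP)
  -- Distinct monomials in the `e_i` have distinct lexicographic leading monomials in the `z_i`, so
  -- the largest one cannot cancel. Its exponent at the first variable is the total degree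
  -- `t.degree`.
  have hlead := supDegree_leadingCoeff_sum_eq (D := toLex) (s := P.support) (i := t)
    (f := fun t => esymmAlgHomMonomial (Fin (n + 1)) t (coeff t P)) ht (fun u hu hut => by
      rw [hsup u hu, hsup t ht]
      exact lt_of_le_of_ne (hmax u hu) (fun h => hut (hinj h)))
  have hsum : ∑ t ∈ P.support, esymmAlgHomMonomial (Fin (n + 1)) t (coeff t P) =
      aeval (elem (n + 1) k) P := by
    conv_rhs => rw [P.as_sum, map_sum]
    exact sum_congr rfl fun t _ => esymmAlgHom_apply _
  rw [hsum, hsup t ht] at hlead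
  have hacc : ∀ u : Fin (n + 1) →₀ ℕ, acc u 0 = u.degree := fun u => by
    simp [acc, Finsupp.degree_eq_sum]
  have hne : aeval (elem (n + 1) k) P ≠ 0 := fun h0 => by
    have h1 := hlead.2
    rw [h0, leadingCoeff_esymmAlgHomMonomial t le_rfl, leadingCoeff_zero] at h1
    exact mem_support_iff.1 ht h1.symm
  have hmem : Finsupp.equivFunOnFinite.symm (acc t) ∈ (aeval (elem (n + 1) k) P).support := by
    obtain ⟨a, ha, hae⟩ := exists_supDegree_mem_support toLex hne
    rw [hlead.1] at hae
    rw [toLex.injective hae]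
    exact ha
  have htd : t.degree ≤ d := by
    rw [← hacc]
    exact (monomial_le_degreeOf 0 hmem).trans (h 0)
  refine Finset.sup_le fun u hu => le_trans ?_ htd
  change u.degree ≤ t.degree
  rw [← hacc, ← hacc]
  by_contra! hlt
  exact (hmax u hu).not_gt ⟨0, fun j hj => absurd hj (Fin.not_lt_zero j), hlt⟩

/-- The homogenization of degree `d`, in the variables `a_0, ..., a_N`. -/
def homogenize (d : ℕ) (P : MvPolynomial (Fin N) k) : MvPolynomial (Fin (N + 1)) k :=
  ∑ t ∈ P.support, monomial (Finsupp.cons (d - t.degree) t) (coeff t P)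

theorem aeval_formCoeff_homogenize (d : ℕ) (P : MvPolynomial (Fin N) k) (h : P.totalDegree ≤ d) :
    aeval (formCoeff N k) (homogenize d P) =
      Polynomial.X ^ d * Polynomial.C (aeval (elem N k) P) := by
  conv_rhs => rw [P.as_sum]
  rw [homogenize, map_sum, map_sum, map_sum, mul_sum]
  refine sum_congr rfl fun t ht => ?_
  have htd : t.degree ≤ d := (le_totalDegree ht).trans h
  rw [aeval_monomial, aeval_monomial, Finsupp.prod_fintype _ _ (fun _ => pow_zero _),
    Finsupp.prod_fintype _ _ (fun _ => pow_zero _), Fin.prod_univ_succ]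
  simp only [formCoeff, Fin.cons_zero, Fin.cons_succ, Finsupp.cons_zero, Finsupp.cons_succ, mul_pow,
    prod_mul_distrib, prod_pow_eq_pow_sum, map_mul, map_prod, map_pow]
  rw [← Finsupp.degree_eq_sum, ← mul_assoc (Polynomial.X ^ (d - t.degree)), ← pow_add,
    Nat.sub_add_cancel htd]
  rw [mul_left_comm]
  rfl

/-- The substitution `z_i ↦ z_i + t`. -/
def shift (N : ℕ) (k : Type*) [Field k] :
    MvPolynomial (Fin N) k →ₐ[k] Polynomial (MvPolynomial (Fin N) k) :=
  aeval fun j => Polynomial.C (X j) + Polynomial.X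

theorem exists_isSemiInvariant (d w : ℕ) (F : MvPolynomial (Fin N) k) (hsymm : F.IsSymmetric)
    (hshift : shift N k F = Polynomial.C F) (hw : F.IsHomogeneous w)
    (hd : ∀ i, F.degreeOf i ≤ d) :
    ∃ Q, IsSemiInvariant (k := k) (N := N) d w Q ∧
      aeval (formCoeff N k) Q = Polynomial.X ^ d * Polynomial.C F := by
  obtain ⟨P, hP⟩ := (esymmAlgHom_fin_bijective k N).2 ⟨F, hsymm⟩
  have hPF : aeval (elem N k) P = F :=
    (esymmAlgHom_apply P).symm.trans (congrArg Subtype.val hP)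
  have htd := totalDegree_le_of_degreeOf_esymm_le d P (fun i => hPF.symm ▸ hd i)
  have hQ := aeval_formCoeff_homogenize d P htd
  have hcomp : (shift N k).comp (aeval (elem N k)) = aeval (shiftedElem N k) := by
    ext i : 1
    simp only [AlgHom.comp_apply, aeval_X]
    rfl
  have hinv : IsTranslationInvariant P := by
    rw [IsTranslationInvariant, ← hcomp, AlgHom.comp_apply, hPF, hshift]
  refine ⟨homogenize d P, ⟨P, hinv, hPF.symm ▸ hw, htd, hQ⟩, ?_⟩
  rw [hQ, hPF]

theorem exists_linearIndependent_isSemiInvariant {ι : Type*} (d w : ℕ)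
    (F : ι → MvPolynomial (Fin N) k) (hF : LinearIndependent k F)
    (hsymm : ∀ i, (F i).IsSymmetric) (hshift : ∀ i, shift N k (F i) = Polynomial.C (F i))
    (hw : ∀ i, (F i).IsHomogeneous w) (hd : ∀ i j, (F i).degreeOf j ≤ d) :
    ∃ Q : ι → MvPolynomial (Fin (N + 1)) k,
      LinearIndependent k Q ∧ ∀ i, IsSemiInvariant d w (Q i) := by
  choose Q hQ hQF using fun i =>
    exists_isSemiInvariant d w (F i) (hsymm i) (hshift i) (hw i) (hd i)
  refine ⟨Q, ?_, hQ⟩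
  let φ : Polynomial (MvPolynomial (Fin N) k) →ₗ[k] MvPolynomial (Fin N) k :=
    (Polynomial.lcoeff (MvPolynomial (Fin N) k) d).restrictScalars k
  -- Taking the coefficient of `a_0 ^ d` recovers `F i` from `Q i`.
  apply LinearIndependent.of_comp (φ ∘ₗ (aeval (formCoeff N k)).toLinearMap)
  convert hF
  ext1 i
  simp only [φ, Function.comp_apply, LinearMap.comp_apply, AlgHom.toLinearMap_apply,
    LinearMap.restrictScalars_apply, hQF, Polynomial.lcoeff_apply, Polynomial.coeff_mul_C,
    Polynomial.coeff_X_pow_self, one_mul]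

end Elementary


/-! ### Symmetrization and degrees. -/

section Symmetrize

variable {ι k : Type*} [Fintype ι] [DecidableEq ι] [Field k]

/-- The sum of all the polynomials obtained by permuting the variables. -/
def symmetrize (p : MvPolynomial ι k) : MvPolynomial ι k :=
  ∑ σ : Equiv.Perm ι, rename σ p

theorem isSymmetric_symmetrize (p : MvPolynomial ι k) : (symmetrize p).IsSymmetric := fun τ => by
  rw [symmetrize, map_sum]
  refine Fintype.sum_equiv (Equiv.mulLeft τ) _ _ fun σ => ?_
  rw [rename_rename]
  rfl

theorem isHomogeneous_symmetrize {p : MvPolynomial ι k} {n : ℕ} (hp : p.IsHomogeneous n) :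
    (symmetrize p).IsHomogeneous n :=
  IsHomogeneous.sum _ _ _ fun _ _ => hp.rename_isHomogeneous

theorem degreeOf_symmetrize_le {p : MvPolynomial ι k} {d : ℕ} (hp : ∀ i, p.degreeOf i ≤ d) (i : ι) :
    (symmetrize p).degreeOf i ≤ d := by
  refine (degreeOf_sum_le i _ _).trans (Finset.sup_le fun σ _ => ?_)
  have h := degreeOf_rename_of_injective (p := p) σ.injective (σ.symm i)
  rw [Equiv.apply_symm_apply] at h
  exact h.trans_le (hp _)

theorem degreeOf_X_sub_X_le (i j l : ι) :
    (X i - X j : MvPolynomial ι k).degreeOf l ≤ if l = i ∨ l = j then 1 else 0 := by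
  refine (degreeOf_sub_le l _ _).trans ?_
  rw [degreeOf_X, degreeOf_X]
  split_ifs <;> simp_all

theorem isHomogeneous_X_sub_X (i j : ι) : (X i - X j : MvPolynomial ι k).IsHomogeneous 1 :=
  (isHomogeneous_X k i).sub (isHomogeneous_X k j)

end Symmetrize

/-! ### Differences across blocks. -/

section Cross

variable {ι β : Type*} [Fintype ι] [DecidableEq ι] [Fintype β] [LinearOrder β]

/-- The pairs of elements from different blocks, the smaller block first. -/
def crossPairs (c : ι → β) : Finset (ι × ι) := univ.filter fun p => c p.1 < c p.2

/-- Ordered pairs lie within one block or go across in one of two equinumerous directions. This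
identifies the degree of `crossProd` with `wt`. -/
theorem two_mul_card_crossPairs_add (c : ι → β) :
    2 * (crossPairs c).card + ∑ b, (univ.filter fun i => c i = b).card ^ 2 =
      Fintype.card ι ^ 2 := by
  have hdiag : (univ.filter fun p : ι × ι => c p.1 = c p.2).card =
      ∑ b, (univ.filter fun i => c i = b).card ^ 2 := by
    rw [card_eq_sum_card_fiberwise (f := fun p => c p.1) (t := univ) (fun _ _ => mem_univ _)]
    refine sum_congr rfl fun b _ => ?_
    rw [sq, ← card_product]
    congr 1
    ext p
    simp only [mem_filter, mem_univ, true_and, mem_product]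
    constructor
    · rintro ⟨h1, h2⟩
      exact ⟨h2, h1 ▸ h2⟩
    · rintro ⟨h1, h2⟩
      exact ⟨h1.trans h2.symm, h1⟩
  have hswap : (univ.filter fun p : ι × ι => c p.2 < c p.1).card = (crossPairs c).card :=
    card_equiv (Equiv.prodComm ι ι) fun p => by simp [crossPairs]
  have htotal : (univ : Finset (ι × ι)).card = Fintype.card ι ^ 2 := by
    rw [card_univ, Fintype.card_prod, sq]
  have h1 := card_filter_add_card_filter_not (s := (univ : Finset (ι × ι)))
    (fun p => c p.1 = c p.2)
  have h2 := card_filter_add_card_filter_not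
    (s := (univ : Finset (ι × ι)).filter fun p => ¬ c p.1 = c p.2) (fun p => c p.1 < c p.2)
  rw [filter_filter, filter_filter] at h2
  have e1 : (univ.filter fun p : ι × ι => ¬ c p.1 = c p.2 ∧ c p.1 < c p.2) = crossPairs c :=
    filter_congr fun p _ => ⟨And.right, fun h => ⟨h.ne, h⟩⟩
  have e2 : (univ.filter fun p : ι × ι => ¬ c p.1 = c p.2 ∧ ¬ c p.1 < c p.2) =
      univ.filter fun p : ι × ι => c p.2 < c p.1 :=
    filter_congr fun p _ => ⟨fun h => lt_of_le_of_ne (not_lt.1 h.2) (Ne.symm h.1),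
      fun h => ⟨h.ne', h.not_gt⟩⟩
  rw [e1, e2, hswap] at h2
  omega

variable (k : Type*) [Field k]

/-- The product of all the differences of variables from different blocks. -/
def crossProd (c : ι → β) : MvPolynomial ι k := ∏ p ∈ crossPairs c, (X p.1 - X p.2)

theorem isHomogeneous_crossProd (c : ι → β) :
    (crossProd k c).IsHomogeneous (crossPairs c).card := by
  have h := IsHomogeneous.prod (crossPairs c) (fun p => (X p.1 - X p.2 : MvPolynomial ι k))
    (fun _ => 1) (fun p _ => isHomogeneous_X_sub_X p.1 p.2)
  rwa [sum_const, smul_eq_mul, mul_one] at h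

theorem degreeOf_crossProd_le (c : ι → β) (i : ι) :
    (crossProd k c).degreeOf i ≤
      Fintype.card ι - (univ.filter fun j => c j = c i).card := by
  have h : (crossProd k c).degreeOf i ≤
      ((crossPairs c).filter fun p => i = p.1 ∨ i = p.2).card := by
    rw [card_filter]
    exact (degreeOf_prod_le i _ _).trans (sum_le_sum fun p _ => degreeOf_X_sub_X_le p.1 p.2 i)
  refine h.trans ?_
  rw [← card_univ, ← card_sdiff_of_subset (filter_subset _ _)]
  -- A pair containing `i` is determined by its other member, which lies outside the block of `i`.
  refine card_le_card_of_injOn (fun p => if i = p.1 then p.2 else p.1) (fun p hp => ?_) ?_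
  · simp only [crossPairs, coe_filter, mem_filter, mem_univ, true_and, Set.mem_ofPred_eq] at hp
    simp only [mem_coe, mem_sdiff, mem_univ, mem_filter, true_and]
    split_ifs with h1
    · rw [h1]; exact hp.1.ne'
    · rw [hp.2.resolve_left h1]; exact hp.1.ne
  · rintro ⟨a, b⟩ hp ⟨a', b'⟩ hq hpq
    simp only [crossPairs, coe_filter, mem_filter, mem_univ, true_and, Set.mem_ofPred_eq] at hp hq
    have := hp.1.ne
    have := hq.1.ne
    have := hp.1.not_gt
    have := hq.1.not_gt
    grind

end Cross

/-! ### Specialization to one value per block. -/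

section Specialize

variable {ι β k R : Type*} [Fintype ι] [DecidableEq ι] [Fintype β] [LinearOrder β] [Field k]
  [CommRing R] [Algebra k R]

/-- The block of `σ i` determines the block of `i`. The resulting map on blocks is surjective, hence
bijective; it then preserves block sizes, so it is the identity. -/
theorem comp_eq_of_separates (c : ι → β) (hc : Function.Surjective c)
    (hcard : Function.Injective fun b => (univ.filter fun i => c i = b).card)
    (σ : Equiv.Perm ι) (h : ∀ i j, c i < c j → c (σ i) ≠ c (σ j)) : c ∘ σ = c := by
  have h' : ∀ i j, c (σ i) = c (σ j) → c i = c j := fun i j hij => by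
    rcases lt_trichotomy (c i) (c j) with hlt | heq | hgt
    · exact absurd hij (h i j hlt)
    · exact heq
    · exact absurd hij.symm (h j i hgt)
  have hsurj : Function.Surjective (c ∘ σ) := hc.comp σ.surjective
  choose g hg using hsurj
  have hφ : ∀ i, c i = c (g (c (σ i))) := fun i => h' _ _ (hg _).symm
  have hφinj : Function.Injective fun b => c (g b) := Finite.injective_iff_surjective.2 fun b => by
    obtain ⟨i, rfl⟩ := hc b
    exact ⟨_, (hφ i).symm⟩
  have hid : ∀ b, c (g b) = b := fun b => hcard <| by
    refine card_equiv σ fun i => ?_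
    simp only [mem_filter, mem_univ, true_and]
    rw [hφ i]
    exact hφinj.eq_iff
  funext i
  rw [hφ i, hid]
  rfl

/-- A permutation that does not preserve the blocks brings two roots from different blocks together
and kills a factor. The others form the stabilizer of `c` and contribute equal terms. -/
theorem aeval_symmetrize_crossProd_mul (c : ι → β) (hc : Function.Surjective c)
    (hcard : Function.Injective fun b => (univ.filter fun i => c i = b).card)
    (v : β → R) (G : MvPolynomial ι k) :
    aeval (v ∘ c) (symmetrize (crossProd k c * G)) =
      ((∏ b, (univ.filter fun i => c i = b).card.factorial : ℕ) : R) *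
        (∏ p ∈ crossPairs c, (v (c p.1) - v (c p.2))) * aeval (v ∘ c) G := by
  classical
  have hterm : ∀ σ : Equiv.Perm ι, aeval (v ∘ c) (rename σ (crossProd k c * G)) =
      if c ∘ σ = c then
        (∏ p ∈ crossPairs c, (v (c p.1) - v (c p.2))) * aeval (v ∘ c) G else 0 := fun σ => by
    rw [aeval_rename, Function.comp_assoc]
    split_ifs with h
    · rw [h, map_mul, crossProd, map_prod]
      simp
    · have : ∃ i j, c i < c j ∧ c (σ i) = c (σ j) := by
        by_contra! hne
        exact h (comp_eq_of_separates c hc hcard σ hne)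
      obtain ⟨i, j, hij, hσ⟩ := this
      rw [map_mul, crossProd, map_prod, prod_eq_zero (i := (i, j)), zero_mul]
      · simp [crossPairs, hij]
      · simp [hσ]
  rw [symmetrize, map_sum, sum_congr rfl fun σ _ => hterm σ, ← sum_filter, sum_const, nsmul_eq_mul,
    mul_assoc]
  congr 2
  have := DomMulAct.stabilizer_card c
  rw [Fintype.card_subtype] at this
  rw [this]
  simp [Fintype.card_subtype]

end Specialize


/-! ### The additional differences. -/

section Spread

variable {ι β : Type*} [Fintype ι] [DecidableEq ι] [Fintype β] [LinearOrder β]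
variable (k : Type*) [Field k]

/-- The product of the differences `z_{g (f l) l} - z_{g b l}`, where `g b' l` is the element
of the block `b'` that is used by the `l`-th factor. -/
def spread {θ : ℕ} (g : β → ℕ → ι) (b : β) (f : Fin θ → β) : MvPolynomial ι k :=
  ∏ l : Fin θ, (X (g (f l) l) - X (g b l))

theorem isHomogeneous_spread {θ : ℕ} (g : β → ℕ → ι) (b : β) (f : Fin θ → β) :
    (spread k g b f).IsHomogeneous θ := by
  have h := IsHomogeneous.prod univ (fun l : Fin θ => (X (g (f l) l) - X (g b l) : MvPolynomial ι k))
    (fun _ => 1) (fun l _ => isHomogeneous_X_sub_X _ _)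
  simpa [spread] using h

/-- The variable `i` can enter the `l`-th factor only as the representative `g (c i) l` of its own
block. -/
theorem degreeOf_spread_le {θ : ℕ} (c : ι → β) (g : β → ℕ → ι) (hg : ∀ b l, c (g b l) = b)
    (b : β) (f : Fin θ → β) (i : ι) :
    (spread k g b f).degreeOf i ≤ (univ.filter fun l : Fin θ => g (c i) l = i).card := by
  rw [card_filter]
  refine (degreeOf_prod_le i _ _).trans (sum_le_sum fun l _ =>
    (degreeOf_X_sub_X_le _ _ i).trans ?_)
  split_ifs with h1 h2 h2
  · exact le_rfl
  · refine absurd ?_ h2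
    rcases h1 with h1 | h1
    · have := hg (f l) l
      rw [← h1] at this
      rw [this, ← h1]
    · have := hg b l
      rw [← h1] at this
      rw [this, ← h1]
  · exact Nat.zero_le 1
  · exact le_rfl

theorem shift_symmetrize_crossProd_mul_spread {N θ : ℕ} (c : Fin N → β) (g : β → ℕ → Fin N) (b : β)
    (f : Fin θ → β) :
    shift N k (symmetrize (crossProd k c * spread k g b f)) =
      Polynomial.C (symmetrize (crossProd k c * spread k g b f)) := by
  simp [symmetrize, crossProd, spread, shift, map_prod, map_sum]

/-- The infinitesimal form of translation invariance, which becomes annihilation by `lower`. -/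
theorem derivation_symmetrize_crossProd_mul_spread {θ : ℕ} (c : ι → β) (g : β → ℕ → ι) (b : β)
    (f : Fin θ → β) (D : Derivation k (MvPolynomial ι k) (MvPolynomial ι k))
    (hD : ∀ i, D (X i) = 1) : D (symmetrize (crossProd k c * spread k g b f)) = 0 := by
  have hmul : ∀ p q : MvPolynomial ι k, D p = 0 → D q = 0 → D (p * q) = 0 := fun p q hp hq => by
    rw [D.leibniz, hp, hq, smul_zero, smul_zero, add_zero]
  rw [symmetrize, map_sum]
  refine sum_eq_zero fun σ _ => ?_
  rw [map_mul, crossProd, spread, map_prod, map_prod]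
  refine hmul _ _ ?_ ?_ <;>
  · refine prod_induction _ (fun p => D p = 0) hmul D.map_one_eq_zero fun p _ => ?_
    simp [hD]

end Spread

/-! ### The independent family of symmetric polynomials. -/

section Construction

theorem card_filter_mod_le {θ M K : ℕ} (hθ : θ ≤ K * M) (r : ℕ) :
    (univ.filter fun l : Fin θ => (l : ℕ) % M = r).card ≤ K := by
  conv_rhs => rw [← card_range K]
  refine card_le_card_of_injOn (fun l => (l : ℕ) / M) (fun l _ => ?_) fun a ha b hb hab => ?_
  · have : (l : ℕ) / M < K := Nat.div_lt_of_lt_mul (by rw [mul_comm]; omega)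
    simpa using this
  · simp only [coe_filter, mem_univ, true_and, Set.mem_ofPred_eq] at ha hb
    apply Fin.ext
    rw [← Nat.div_add_mod (a : ℕ) M, ← Nat.div_add_mod (b : ℕ) M, ha, hb]
    dsimp only at hab
    rw [hab]

/-- The order of the stabilizer of the blocks must be invertible; this is where the characteristic
matters. -/
theorem natCast_prod_factorial_ne_zero {k : Type*} [Field k] {N : ℕ}
    (hk : ringChar k = 0 ∨ N < ringChar k) {β : Type*} [Fintype β] (m : β → ℕ) (hm : ∀ b, m b ≤ N) :
    ((∏ b, (m b).factorial : ℕ) : k) ≠ 0 := by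
  rw [Nat.cast_prod, prod_ne_zero_iff]
  intro b _ h0
  rw [ringChar.spec] at h0
  rcases hk with hk | hk
  · rw [hk, zero_dvd_iff] at h0
    exact Nat.factorial_ne_zero _ h0
  · have hp : (ringChar k).Prime :=
      (CharP.char_is_prime_or_zero k (ringChar k)).resolve_right (by omega)
    have := (hp.dvd_factorial).1 h0
    have := hm b
    omega

/-- A sequence that lists the elements of a multiset of cardinality `θ`. -/
def symSeq {α : Type*} {θ : ℕ} (x : Sym α θ) (l : Fin θ) : α :=
  (x : Multiset α).toList.get (l.cast (by simp))

theorem prod_symSeq {α M : Type*} [CommMonoid M] {θ : ℕ} (x : Sym α θ) (h : α → M) :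
    ∏ l, h (symSeq x l) = ((x : Multiset α).map h).prod := by
  have hlen : θ = (x : Multiset α).toList.length := by simp
  conv_rhs => rw [← Multiset.coe_toList (x : Multiset α), Multiset.map_coe, Multiset.prod_coe,
    ← List.ofFn_get (x : Multiset α).toList, List.map_ofFn, List.prod_ofFn]
  exact Fintype.prod_equiv (finCongr hlen) _ _ fun l => rfl

theorem prod_map_X_eq_monomial {σ k : Type*} [DecidableEq σ] [CommSemiring k] (t : Multiset σ) :
    (t.map (X : σ → MvPolynomial σ k)).prod = monomial (Multiset.toFinsupp t) 1 := by
  induction t using Multiset.induction_on with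
  | empty => simp
  | cons a t ih =>
    rw [Multiset.map_cons, Multiset.prod_cons, ih, ← Multiset.singleton_add, map_add,
      Multiset.toFinsupp_singleton, X, monomial_mul, mul_one]

theorem linearIndependent_prod_map_X (σ k : Type*) [Field k] :
    LinearIndependent k fun t : Multiset σ => (t.map (X : σ → MvPolynomial σ k)).prod := by
  classical
  have h : LinearIndependent k fun t : σ →₀ ℕ => monomial t (1 : k) := by
    rw [← coe_basisMonomials]
    exact (basisMonomials σ k).linearIndependent
  simp only [prod_map_X_eq_monomial]
  exact h.comp _ Multiset.toFinsupp.injective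

theorem linearIndependent_mul_prod_X {σ k : Type*} [Field k] (θ : ℕ)
    {A : MvPolynomial σ k} (hA : A ≠ 0) :
    LinearIndependent k fun x : Sym σ θ => A * ((x : Multiset σ).map X).prod :=
  ((linearIndependent_prod_map_X σ k).comp (fun x : Sym σ θ => (x : Multiset σ))
    Subtype.val_injective).map' (LinearMap.mulLeft k A)
    (LinearMap.ker_eq_bot.2 (mul_right_injective₀ hA))

/-- Puts the cases of `degBound` in one form: `K` bounds how often a root is used when `θ` factors
cycle through the smallest block. The generic case leaves one unit of degree to spare. -/
theorem exists_degree_excess {N w d s : ℕ} {m : Fin (s + 1) → ℕ}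
    (hm : IsDistinctPartition N s m) (hw : 1 + wt N m ≤ w) (hd : degBound N w m ≤ d) :
    ∃ K, N - m 0 + K ≤ d ∧ w - wt N m ≤ K * m 0 := by
  obtain ⟨hmono, hpos, hsum⟩ := hm
  have hm0 : m 0 ≤ N := by
    rw [← hsum]; exact single_le_sum (f := m) (fun _ _ => Nat.zero_le _) (mem_univ 0)
  rw [degBound] at hd
  split_ifs at hd with h
  · rcases h with h | h
    · exact ⟨w - wt N m, by omega, by rw [h, mul_one]⟩
    · have : w - wt N m = 1 := by omega
      exact ⟨1, by omega, by omega⟩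
  · refine ⟨⌈((w - wt N m : ℕ) : ℚ) / (m 0 : ℚ)⌉₊, by omega, ?_⟩
    have hq : (0 : ℚ) < m 0 := by exact_mod_cast hpos
    have := Nat.le_ceil (((w - wt N m : ℕ) : ℚ) / (m 0 : ℚ))
    rw [div_le_iff₀ hq] at this
    exact_mod_cast this

theorem exists_linearIndependent_symmetric {N : ℕ} (k : Type*) [Field k]
    (hk : ringChar k = 0 ∨ N < ringChar k) {s : ℕ} (hs : 1 ≤ s)
    {m : Fin (s + 1) → ℕ} (hm : IsDistinctPartition N s m)
    {w : ℕ} (hw : 1 + wt N m ≤ w) {d : ℕ} (hd : degBound N w m ≤ d) :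
    ∃ F : Fin (nu N w m) → MvPolynomial (Fin N) k, LinearIndependent k F ∧
      ∀ i, (F i).IsSymmetric ∧ shift N k (F i) = Polynomial.C (F i) ∧ (F i).IsHomogeneous w ∧
        (∀ j, (F i).degreeOf j ≤ d) ∧
        ∀ D : Derivation k (MvPolynomial (Fin N) k) (MvPolynomial (Fin N) k),
          (∀ j, D (X j) = 1) → D (F i) = 0 := by
  obtain ⟨K, hKd, hKθ⟩ := exists_degree_excess hm hw hd
  obtain ⟨hmono, hpos, hsum⟩ := hm
  have hmpos : ∀ b, 0 < m b := fun b => lt_of_lt_of_le hpos (hmono.monotone (Fin.zero_le b))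
  have hmN : ∀ b, m b ≤ N := fun b => by
    rw [← hsum]; exact single_le_sum (f := m) (fun _ _ => Nat.zero_le _) (mem_univ b)
  set θ := w - wt N m with hθ
  let e : (Σ b, Fin (m b)) ≃ Fin N := finSigmaFinEquiv.trans (finCongr hsum)
  let c : Fin N → Fin (s + 1) := fun i => (e.symm i).1
  let g : Fin (s + 1) → ℕ → Fin N := fun b l => e ⟨b, ⟨l % m b, Nat.mod_lt _ (hmpos b)⟩⟩
  have hcg : ∀ b l, c (g b l) = b := fun b l => by simp [c, g]
  have hc : Function.Surjective c := fun b => ⟨g b 0, hcg b 0⟩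
  have hcard : ∀ b, (univ.filter fun i => c i = b).card = m b := fun b => by
    rw [← card_fin (m b)]
    symm
    refine card_bij (fun a _ => e ⟨b, a⟩) (fun a _ => by simp [c]) (fun a _ a' _ h => ?_)
      fun i hi => ?_
    · simpa using h
    · obtain ⟨⟨b', a⟩, rfl⟩ := e.surjective i
      have : b' = b := by simpa [c] using hi
      subst this
      exact ⟨a, mem_univ _, rfl⟩
  -- A multiset of `θ` blocks other than block 0 prescribes the minuends; block 0, the smallest,
  -- supplies the subtrahends.
  let F : Sym (Fin s) θ → MvPolynomial (Fin N) k := fun x =>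
    symmetrize (crossProd k c * spread k g 0 fun l => (symSeq x l).succ)
  have hcross : (crossPairs c).card = wt N m := by
    have h1 := two_mul_card_crossPairs_add c
    have h2 := two_mul_wt_add m hsum
    simp only [hcard, Fintype.card_fin] at h1
    omega
  have hdeg : ∀ x j, (F x).degreeOf j ≤ d := fun x j => by
    refine degreeOf_symmetrize_le (fun i => ?_) j
    refine (degreeOf_mul_le i _ _).trans ?_
    have h1 := degreeOf_crossProd_le k c i
    rw [hcard, Fintype.card_fin] at h1
    have h2 := degreeOf_spread_le k c g hcg 0 (fun l => (symSeq x l).succ) i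
    -- A larger block has more roots to cycle through and a smaller degree in `crossProd`, so the
    -- smallest block is the worst case.
    have h3 : θ ≤ (d - (N - m (c i))) * m (c i) := by
      have h4 : m 0 ≤ m (c i) := hmono.monotone (Fin.zero_le _)
      have h5 := hmN (c i)
      exact hKθ.trans (Nat.mul_le_mul (by omega) h4)
    have h6 : (univ.filter fun l : Fin θ => g (c i) l = i).card ≤ d - (N - m (c i)) := by
      refine le_trans (card_le_card fun l hl => ?_) (card_filter_mod_le h3 (e.symm i).2)
      simp only [mem_filter, mem_univ, true_and] at hl ⊢
      exact congrArg (fun y : Σ b, Fin (m b) => (y.2 : ℕ)) ((e.eq_symm_apply).2 hl)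
    have h8 : N - m (c i) ≤ d := by
      have h4 : m 0 ≤ m (c i) := hmono.monotone (Fin.zero_le _)
      omega
    omega
  have hlin : LinearIndependent k F := by
    -- With block 0 sent to 0, each extra difference becomes a single variable and `spread` becomes
    -- the monomial of `x`.
    let v : Fin (s + 1) → MvPolynomial (Fin s) k := Fin.cons 0 X
    have hv : Function.Injective v := by
      refine Fin.cons_injective_iff.2 ⟨?_, X_injective⟩
      rintro ⟨i, hi⟩
      exact X_ne_zero i hi
    apply LinearIndependent.of_comp (aeval (v ∘ c)).toLinearMap
    set A : MvPolynomial (Fin s) k :=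
      ((∏ b, (univ.filter fun i => c i = b).card.factorial : ℕ) : MvPolynomial (Fin s) k) *
        (∏ p ∈ crossPairs c, (v (c p.1) - v (c p.2))) with hA
    have hA0 : A ≠ 0 := by
      refine mul_ne_zero ?_ (prod_ne_zero_iff.2 fun p hp => sub_ne_zero.2 fun h => ?_)
      · rw [← map_natCast (C (σ := Fin s) (R := k)), Ne, C_eq_zero]
        exact natCast_prod_factorial_ne_zero hk _ fun b => (hcard b).trans_le (hmN b)
      · exact (mem_filter.1 hp).2.ne (hv h)
    have hFx : (aeval (v ∘ c)).toLinearMap ∘ F =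
        fun x : Sym (Fin s) θ => A * ((x : Multiset (Fin s)).map X).prod := funext fun x => by
      simp only [Function.comp_apply, AlgHom.toLinearMap_apply, F]
      rw [aeval_symmetrize_crossProd_mul c hc (by simpa only [hcard] using hmono.injective), ← hA,
        ← prod_symSeq, spread, map_prod]
      congr 1
      refine prod_congr rfl fun l _ => ?_
      simp [hcg, v]
    rw [hFx]
    exact linearIndependent_mul_prod_X θ hA0
  have hnu : Fintype.card (Sym (Fin s) θ) = nu N w m := by
    rw [Sym.card_sym_eq_choose, Fintype.card_fin, nu, ← hθ]
    rw [show s + θ - 1 = s - 1 + θ by omega]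
    exact (Nat.choose_symm_of_eq_add (by omega)).symm
  let E := (Fintype.equivFinOfCardEq hnu).symm
  refine ⟨F ∘ E, hlin.comp _ E.injective, fun i => ⟨isSymmetric_symmetrize _,
    shift_symmetrize_crossProd_mul_spread k c g 0 _, ?_, hdeg _,
    derivation_symmetrize_crossProd_mul_spread k c g 0 _⟩⟩
  refine isHomogeneous_symmetrize ?_
  have h := (isHomogeneous_crossProd k c).mul
    (isHomogeneous_spread k g 0 fun l => (symSeq (E i) l).succ)
  rw [hcross] at h
  convert h using 1
  omega

end Construction


/-! ### The action of `sl₂` and surjectivity of lowering. -/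

section Sl2

/-- The derivation `X j ↦ j X (j - 1)`. -/
def lower : Derivation ℚ (MvPolynomial ℕ ℚ) (MvPolynomial ℕ ℚ) :=
  mkDerivation ℚ fun j => (j : ℚ) • X (j - 1)

/-- The derivation `X j ↦ (d - j) X (j + 1)`. -/
def raise (d : ℕ) : Derivation ℚ (MvPolynomial ℕ ℚ) (MvPolynomial ℕ ℚ) :=
  mkDerivation ℚ fun j => ((d : ℚ) - j) • X (j + 1)

/-- The multisets of cardinality `n` and sum `w` with elements at most `d`. -/
def boxIndex (d n : ℕ) (w : ℤ) : Set (Multiset ℕ) :=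
  {t | t.card = n ∧ (t.sum : ℤ) = w ∧ ∀ x ∈ t, x ≤ d}

/-- The span of the products of `n` variables with indices at most `d` and of sum `w`. -/
def boxSpace (d n : ℕ) (w : ℤ) : Submodule ℚ (MvPolynomial ℕ ℚ) :=
  Submodule.span ℚ ((fun t : Multiset ℕ => (t.map X).prod) '' boxIndex d n w)

theorem prod_mem_boxSpace {d : ℕ} {t : Multiset ℕ} (ht : ∀ x ∈ t, x ≤ d) :
    (t.map X).prod ∈ boxSpace d t.card t.sum :=
  Submodule.subset_span ⟨t, ⟨rfl, rfl, ht⟩, rfl⟩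

theorem X_mul_mem_boxSpace {d n : ℕ} {w v : ℤ} {a : ℕ} (ha : a ≤ d) {p : MvPolynomial ℕ ℚ}
    (hp : p ∈ boxSpace d n w) (hv : v = w + a) : X a * p ∈ boxSpace d (n + 1) v := by
  have h : boxSpace d n w ≤ (boxSpace d (n + 1) v).comap (LinearMap.mulLeft ℚ (X a)) := by
    refine Submodule.span_le.2 ?_
    rintro _ ⟨t, ⟨h1, h2, h3⟩, rfl⟩
    refine Submodule.subset_span ⟨a ::ₘ t, ⟨by simp [h1], by simp [h2, hv, add_comm], ?_⟩, by simp⟩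
    simpa [ha] using h3
  exact h hp

theorem derivation_prod_mem_boxSpace {d : ℕ} (δ : ℤ)
    (D : Derivation ℚ (MvPolynomial ℕ ℚ) (MvPolynomial ℕ ℚ))
    (hD : ∀ a ≤ d, ∀ n w, ∀ p ∈ boxSpace d n w, D (X a) * p ∈ boxSpace d (n + 1) (w + a + δ))
    (t : Multiset ℕ) (ht : ∀ x ∈ t, x ≤ d) :
    D (t.map X).prod ∈ boxSpace d t.card (t.sum + δ) := by
  induction t using Multiset.induction_on with
  | empty => simp
  | cons a t ih =>
    have ha := ht a (Multiset.mem_cons_self a t)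
    have ht' : ∀ x ∈ t, x ≤ d := fun x hx => ht x (Multiset.mem_cons_of_mem hx)
    rw [Multiset.map_cons, Multiset.prod_cons, D.leibniz, smul_eq_mul, smul_eq_mul,
      Multiset.card_cons, Multiset.sum_cons]
    refine add_mem (X_mul_mem_boxSpace ha (ih ht') (by push_cast; ring)) ?_
    rw [mul_comm]
    convert hD a ha _ _ _ (prod_mem_boxSpace ht') using 1
    push_cast
    ring_nf

theorem derivation_mem_boxSpace {d n : ℕ} {w : ℤ} (δ : ℤ)
    (D : Derivation ℚ (MvPolynomial ℕ ℚ) (MvPolynomial ℕ ℚ))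
    (hD : ∀ a ≤ d, ∀ n w, ∀ p ∈ boxSpace d n w, D (X a) * p ∈ boxSpace d (n + 1) (w + a + δ))
    {p : MvPolynomial ℕ ℚ} (hp : p ∈ boxSpace d n w) : D p ∈ boxSpace d n (w + δ) := by
  have h : boxSpace d n w ≤ (boxSpace d n (w + δ)).comap (D : MvPolynomial ℕ ℚ →ₗ[ℚ] _) := by
    refine Submodule.span_le.2 ?_
    rintro _ ⟨t, ⟨rfl, rfl, h3⟩, rfl⟩
    exact derivation_prod_mem_boxSpace δ D hD t h3
  exact h hp

theorem lower_mem_boxSpace {d n : ℕ} {w : ℤ} {p : MvPolynomial ℕ ℚ} (hp : p ∈ boxSpace d n w) :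
    lower p ∈ boxSpace d n (w - 1) := by
  refine derivation_mem_boxSpace (-1) lower (fun a ha n w p hp => ?_) hp
  rw [lower, mkDerivation_X, smul_mul_assoc]
  -- The truncated index `0 - 1` carries the coefficient 0.
  rcases a with _ | a
  · simp
  · exact Submodule.smul_mem _ _ (X_mul_mem_boxSpace (by omega) hp (by push_cast; ring))

theorem raise_mem_boxSpace {d n : ℕ} {w : ℤ} {p : MvPolynomial ℕ ℚ} (hp : p ∈ boxSpace d n w) :
    raise d p ∈ boxSpace d n (w + 1) := by
  refine derivation_mem_boxSpace 1 (raise d) (fun a ha n w p hp => ?_) hp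
  rw [raise, mkDerivation_X, smul_mul_assoc]
  -- The coefficient `d - a` vanishes at `a = d`, so no index leaves the box.
  rcases ha.eq_or_lt with rfl | ha
  · simp
  · exact Submodule.smul_mem _ _ (X_mul_mem_boxSpace (by omega) hp (by push_cast; ring))

theorem lie_lower_raise_prod (d : ℕ) (t : Multiset ℕ) :
    ⁅lower, raise d⁆ (t.map X).prod = ((d : ℚ) * t.card - 2 * t.sum) • (t.map X).prod := by
  have hX : ∀ a : ℕ, ⁅lower, raise d⁆ (X a) = ((d : ℚ) - 2 * a) • X a := fun a => by
    rw [Derivation.commutator_apply]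
    simp only [lower, raise, mkDerivation_X, Derivation.map_smul, smul_smul]
    rcases a with _ | a
    · simp
    · simp only [Nat.add_sub_cancel, ← sub_smul]
      congr 1
      push_cast
      ring
  induction t using Multiset.induction_on with
  | empty => simp
  | cons a t ih =>
    rw [Multiset.map_cons, Multiset.prod_cons, Derivation.leibniz, ih, hX, Multiset.card_cons,
      Multiset.sum_cons, smul_eq_mul, smul_eq_mul, mul_smul_comm, mul_smul_comm,
      mul_comm _ (X a), ← add_smul]
    congr 1
    push_cast
    ring

theorem lower_raise_sub {d n : ℕ} {w : ℤ} {p : MvPolynomial ℕ ℚ} (hp : p ∈ boxSpace d n w) :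
    lower (raise d p) - raise d (lower p) = ((d : ℚ) * n - 2 * w) • p := by
  rw [← Derivation.commutator_apply]
  have h : boxSpace d n w ≤ LinearMap.eqLocus
      (⁅lower, raise d⁆ : Derivation ℚ (MvPolynomial ℕ ℚ) _).toLinearMap
      (((d : ℚ) * n - 2 * w) • LinearMap.id) := by
    refine Submodule.span_le.2 ?_
    rintro _ ⟨t, ⟨rfl, rfl, h3⟩, rfl⟩
    exact lie_lower_raise_prod d t
  exact h hp

/-- With integer weights, descent by `lower` ends in the zero space. -/
theorem boxSpace_eq_bot {d n : ℕ} {w : ℤ} (hw : w < 0) : boxSpace d n w = ⊥ := by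
  rw [boxSpace, Submodule.span_eq_bot]
  rintro _ ⟨t, ⟨-, h, -⟩, rfl⟩
  omega

/-- By the commutator relation, `lower p` satisfies the same equation one weight down, with an even
smaller eigenvalue, so it vanishes by induction. Then a negative multiple of `p` is zero. -/
theorem eq_zero_of_lower_raise_eq_smul {d n : ℕ} (r : ℕ) {w : ℤ} (hr : w < r)
    (hw : 2 * w < d * n) {p : MvPolynomial ℕ ℚ} (hp : p ∈ boxSpace d n w) {c : ℚ} (hc : c ≤ 0)
    (h : lower (raise d p) = c • p) : p = 0 := by
  induction r generalizing w p c with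
  | zero => rwa [boxSpace_eq_bot (by simpa using hr), Submodule.mem_bot] at hp
  | succ r ih =>
    have hpos : (0 : ℚ) < (d : ℚ) * n - 2 * w := by
      rw [sub_pos]; exact_mod_cast hw
    have h1 : raise d (lower p) = (c - ((d : ℚ) * n - 2 * w)) • p := by
      rw [sub_smul, ← lower_raise_sub hp, ← h, sub_sub_cancel]
    have h2 : lower p = 0 := by
      refine ih (w := w - 1) (c := c - ((d : ℚ) * n - 2 * w)) (by push_cast at hr; omega)
        (by omega) (lower_mem_boxSpace hp) (by linarith) ?_
      rw [h1, Derivation.map_smul]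
    rw [h2, map_zero] at h1
    exact (smul_eq_zero.1 h1.symm).resolve_left (by linarith)

theorem finite_boxIndex (d n : ℕ) (w : ℤ) :
    (boxIndex d n w).Finite := by
  refine (((range (d + 1)).sym n).finite_toSet.image (fun t : Sym ℕ n => (t : Multiset ℕ))).subset ?_
  rintro t ⟨h1, -, h3⟩
  refine ⟨Sym.mk t h1, ?_, rfl⟩
  rw [mem_coe, mem_sym_iff]
  intro a ha
  exact mem_range.2 (Nat.lt_succ_of_le (h3 a ha))

instance (d n : ℕ) (w : ℤ) : FiniteDimensional ℚ (boxSpace d n w) :=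
  FiniteDimensional.span_of_finite ℚ ((finite_boxIndex d n w).image _)

theorem finrank_boxSpace (d n : ℕ) (w : ℤ) :
    Module.finrank ℚ (boxSpace d n w) =
      (boxIndex d n w).ncard := by
  have hfin := finite_boxIndex d n w
  have := hfin.fintype
  have h := (linearIndependent_prod_map_X ℕ ℚ).comp
    (fun t : boxIndex d n w => (t : Multiset ℕ)) Subtype.val_injective
  rw [boxSpace, Set.image_eq_range, ← Nat.card_coe_set_eq, Nat.card_eq_fintype_card]
  exact finrank_span_eq_card h

/-- On weight `w - 1`, below the middle, `lower ∘ raise` is injective, hence bijective by finite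
dimension. So `lower` is surjective, and rank-nullity gives the dimension of its kernel. -/
theorem card_add_finrank_boxSpace_le {ι : Type*} [Fintype ι] {d n : ℕ} {w : ℤ}
    (hw : 2 * w ≤ d * n) (G : ι → MvPolynomial ℕ ℚ) (hG : LinearIndependent ℚ G)
    (hbox : ∀ i, G i ∈ boxSpace d n w) (hlow : ∀ i, lower (G i) = 0) :
    Fintype.card ι + Module.finrank ℚ (boxSpace d n (w - 1)) ≤
      Module.finrank ℚ (boxSpace d n w) := by
  let ℓ : boxSpace d n w →ₗ[ℚ] boxSpace d n (w - 1) :=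
    (lower : MvPolynomial ℕ ℚ →ₗ[ℚ] MvPolynomial ℕ ℚ).restrict fun _ hp => lower_mem_boxSpace hp
  let u : boxSpace d n (w - 1) →ₗ[ℚ] boxSpace d n w :=
    (raise d : MvPolynomial ℕ ℚ →ₗ[ℚ] MvPolynomial ℕ ℚ).restrict fun p hp => by
      simpa using raise_mem_boxSpace hp
  have hinj : Function.Injective (ℓ ∘ₗ u) := by
    rw [← LinearMap.ker_eq_bot, LinearMap.ker_eq_bot']
    rintro ⟨p, hp⟩ h0
    have h1 : lower (raise d p) = 0 := congrArg Subtype.val h0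
    exact Subtype.ext (eq_zero_of_lower_raise_eq_smul w.toNat (by omega) (by omega) hp le_rfl
      (by rw [h1, zero_smul]))
  have hsurj : Function.Surjective ℓ := Function.Surjective.of_comp
    (g := u) (LinearMap.injective_iff_surjective.1 hinj)
  have hker : Fintype.card ι ≤ Module.finrank ℚ (LinearMap.ker ℓ) := by
    let G' : ι → LinearMap.ker ℓ := fun i => ⟨⟨G i, hbox i⟩, Subtype.ext (hlow i)⟩
    have hG' : LinearIndependent ℚ G' :=
      LinearIndependent.of_comp ((boxSpace d n w).subtype ∘ₗ (LinearMap.ker ℓ).subtype) hG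
    exact hG'.fintype_card_le_finrank
  have h := LinearMap.finrank_range_add_finrank_ker ℓ
  rw [LinearMap.range_eq_top.2 hsurj, finrank_top] at h
  omega

end Sl2

/-! ### Passing from exponents of roots to indices of variables. -/

section Polarize

variable {N : ℕ}

/-- The linear map that sends `z^a` to `∏ i, X (a i)`. -/
def polarize (N : ℕ) : MvPolynomial (Fin N) ℚ →ₗ[ℚ] MvPolynomial ℕ ℚ :=
  (basisMonomials (Fin N) ℚ).constr ℚ fun a => ∏ i, X (a i)

theorem polarize_monomial (a : Fin N →₀ ℕ) (r : ℚ) :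
    polarize N (monomial a r) = r • ∏ i, X (a i) := by
  have h := (basisMonomials (Fin N) ℚ).constr_basis ℚ
    (fun a => ∏ i, (X (a i) : MvPolynomial ℕ ℚ)) a
  rw [coe_basisMonomials] at h
  rw [← h, ← mul_one r, ← smul_eq_mul, ← smul_monomial, map_smul, smul_eq_mul, mul_one]
  rfl

theorem derivation_prod {ι A : Type*} [DecidableEq ι] [CommRing A] [Algebra ℚ A]
    (D : Derivation ℚ A A) (s : Finset ι) (f : ι → A) :
    D (∏ i ∈ s, f i) = ∑ i ∈ s, (∏ j ∈ s.erase i, f j) * D (f i) := by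
  induction s using Finset.induction_on with
  | empty => simp
  | insert a s ha ih =>
    rw [prod_insert ha, D.leibniz, ih, sum_insert ha, erase_insert ha, smul_eq_mul, smul_eq_mul,
      add_comm, mul_sum]
    congr 1
    refine sum_congr rfl fun i hi => ?_
    have hia : a ≠ i := fun h => ha (h ▸ hi)
    rw [erase_insert_of_ne hia, prod_insert (fun h => ha (mem_of_mem_erase h)), mul_assoc]

/-- Both operators lower one `a i` by 1 with factor `a i`: an exponent on one side, an index on the
other. -/
theorem lower_polarize (p : MvPolynomial (Fin N) ℚ) :
    lower (polarize N p) = polarize N (mkDerivation ℚ (fun _ => 1) p) := by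
  induction p using MvPolynomial.induction_on' with
  | add p q hp hq => simp only [map_add, hp, hq]
  | monomial a r =>
    rw [polarize_monomial, Derivation.map_smul, derivation_prod, mkDerivation_monomial,
      map_smul, Finsupp.sum_fintype _ _ (fun i => by simp), map_sum]
    congr 1
    refine sum_congr rfl fun i _ => ?_
    rw [smul_eq_mul, mul_one, polarize_monomial, ← mul_prod_erase univ _ (mem_univ i), lower,
      mkDerivation_X]
    have h : ∏ j ∈ univ.erase i, X ((a - Finsupp.single i 1 : Fin N →₀ ℕ) j) =
        ∏ j ∈ univ.erase i, (X (a j) : MvPolynomial ℕ ℚ) := prod_congr rfl fun j hj => by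
      simp [(ne_of_mem_erase hj).symm]
    rw [h]
    simp [mul_comm]

theorem prod_X_eq_prod_map (a : Fin N →₀ ℕ) :
    ∏ i, (X (a i) : MvPolynomial ℕ ℚ) = (((univ.val.map a).map X).prod) := by
  rw [Multiset.map_map]
  rfl

theorem polarize_mem_boxSpace {d w : ℕ} {F : MvPolynomial (Fin N) ℚ} (hw : F.IsHomogeneous w)
    (hd : ∀ i, F.degreeOf i ≤ d) : polarize N F ∈ boxSpace d N w := by
  rw [F.as_sum, map_sum]
  refine sum_mem fun a ha => ?_
  rw [polarize_monomial, prod_X_eq_prod_map]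
  refine Submodule.smul_mem _ _ (Submodule.subset_span ⟨_, ⟨by simp, ?_, ?_⟩, rfl⟩)
  · have h := hw (mem_support_iff.1 ha)
    have h' : a.degree = w := (congrFun (congrArg _ Finsupp.degree_eq_weight_one) a).trans h
    rw [Finsupp.degree_eq_sum] at h'
    exact_mod_cast h'
  · intro x hx
    obtain ⟨i, -, rfl⟩ := Multiset.mem_map.1 hx
    exact (monomial_le_degreeOf i ha).trans (hd i)

theorem exists_perm_of_map_univ_eq {ι α : Type*} [Fintype ι] [DecidableEq α] {a b : ι → α}
    (h : (univ.val.map a : Multiset α) = univ.val.map b) : ∃ σ : Equiv.Perm ι, a = b ∘ σ := by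
  have hcard : ∀ x, Fintype.card {i // a i = x} = Fintype.card {i // b i = x} := fun x => by
    have := congrArg (Multiset.count x) h
    rw [Multiset.count_map, Multiset.count_map] at this
    rw [Fintype.card_subtype, Fintype.card_subtype, Finset.card, Finset.card, filter_val,
      filter_val]
    simpa only [eq_comm] using this
  let E := (Equiv.sigmaFiberEquiv a).symm.trans
    ((Equiv.sigmaCongrRight fun x => Fintype.equivOfCardEq (hcard x)).trans
      (Equiv.sigmaFiberEquiv b))
  refine ⟨E, funext fun i => ?_⟩
  exact (Fintype.equivOfCardEq (hcard (a i)) ⟨i, rfl⟩).2.symm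

/-- Monomials with the same image are permutations of each other, and `F` has the same coefficient
at all of them. Hence coefficients add up to a positive multiple and cannot cancel. -/
theorem eq_zero_of_polarize_eq_zero {F : MvPolynomial (Fin N) ℚ} (hF : F.IsSymmetric)
    (h0 : polarize N F = 0) : F = 0 := by
  classical
  by_contra hne
  obtain ⟨a, ha⟩ := support_nonempty.2 hne
  have h1 := congrArg (coeff (Multiset.toFinsupp (univ.val.map a))) h0
  rw [F.as_sum, map_sum, coeff_sum, coeff_zero] at h1
  have h2 : ∀ b ∈ F.support, coeff (Multiset.toFinsupp (univ.val.map a))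
      (polarize N (monomial b (coeff b F))) =
        if univ.val.map b = univ.val.map a then coeff a F else 0 := fun b _ => by
    rw [polarize_monomial, prod_X_eq_prod_map, prod_map_X_eq_monomial, coeff_smul, coeff_monomial]
    simp only [Multiset.toFinsupp.injective.eq_iff]
    split_ifs with hba
    · obtain ⟨σ, hσ⟩ := exists_perm_of_map_univ_eq hba
      have h3 : coeff (Finsupp.mapDomain σ b) F = coeff b F := by
        conv_lhs => rw [← hF σ]
        exact coeff_rename_mapDomain σ σ.injective F b
      have h4 : Finsupp.mapDomain σ b = a := by
        ext i
        rw [Finsupp.mapDomain_equiv_apply, hσ]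
        simp
      rw [smul_eq_mul, mul_one, ← h3, h4]
    · simp
  rw [sum_congr rfl h2, ← sum_filter, sum_const, smul_eq_zero, card_eq_zero] at h1
  rcases h1 with h1 | h1
  · exact notMem_empty a (h1 ▸ mem_filter.2 ⟨ha, rfl⟩)
  · exact mem_support_iff.1 ha h1

theorem linearIndependent_polarize {ι : Type*} {F : ι → MvPolynomial (Fin N) ℚ}
    (hF : LinearIndependent ℚ F) (hsymm : ∀ i, (F i).IsSymmetric) :
    LinearIndependent ℚ (polarize N ∘ F) := by
  refine hF.map (Submodule.disjoint_def.2 fun p hp hp0 => eq_zero_of_polarize_eq_zero ?_ hp0)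
  have h : Submodule.span ℚ (Set.range F) ≤
      Subalgebra.toSubmodule (symmetricSubalgebra (Fin N) ℚ) := by
    refine Submodule.span_le.2 ?_
    rintro _ ⟨i, rfl⟩
    exact hsymm i
  exact h hp

end Polarize


/-! ### Partitions in a box and `q`-binomial coefficients. -/

section Count

theorem boxIndex_of_forall_eq_zero {d n : ℕ} (h : d = 0 ∨ n = 0) (w : ℤ) :
    boxIndex d n w = if w = 0 then {Multiset.replicate n 0} else ∅ := by
  ext t
  have key : (t.card = n ∧ ∀ x ∈ t, x ≤ d) ↔ t = Multiset.replicate n 0 := by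
    rw [Multiset.eq_replicate]
    rcases h with rfl | rfl
    · simp
    · simp +contextual
  have hmem : t ∈ boxIndex d n w ↔ t = Multiset.replicate n 0 ∧ (t.sum : ℤ) = w := by
    rw [← key, boxIndex, Set.mem_ofPred_eq]
    tauto
  rw [hmem]
  split_ifs with hw
  · subst hw
    simp +contextual
  · simp only [Set.mem_empty_iff_false, iff_false]
    rintro ⟨rfl, h⟩
    simp at h
    exact hw h.symm

/-- Split by whether the largest allowed part `d + 1` occurs; this matches the `q`-Pascal rule. -/
theorem ncard_boxIndex_succ_succ (d n : ℕ) (w : ℤ) :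
    (boxIndex (d + 1) (n + 1) w).ncard =
      (boxIndex d (n + 1) w).ncard + (boxIndex (d + 1) n (w - (d + 1))).ncard := by
  have hunion : boxIndex (d + 1) (n + 1) w =
      boxIndex d (n + 1) w ∪ Multiset.cons (d + 1) '' boxIndex (d + 1) n (w - (d + 1)) := by
    ext t
    simp only [boxIndex, Set.mem_union, Set.mem_ofPred_eq, Set.mem_image]
    constructor
    · rintro ⟨h1, h2, h3⟩
      by_cases hd : d + 1 ∈ t
      · obtain ⟨u, rfl⟩ := Multiset.exists_cons_of_mem hd
        simp only [Multiset.card_cons, Multiset.sum_cons, Multiset.mem_cons] at h1 h2 h3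
        rw [Nat.cast_add, Nat.cast_succ] at h2
        exact Or.inr ⟨u, ⟨by omega, by omega, fun x hx => h3 x (Or.inr hx)⟩, rfl⟩
      · refine Or.inl ⟨h1, h2, fun x hx => ?_⟩
        have := h3 x hx
        have : x ≠ d + 1 := fun h => hd (h ▸ hx)
        omega
    · rintro (⟨h1, h2, h3⟩ | ⟨u, ⟨h1, h2, h3⟩, rfl⟩)
      · exact ⟨h1, h2, fun x hx => (h3 x hx).trans (Nat.le_succ d)⟩
      · refine ⟨by simp [h1], ?_, by simpa using h3⟩
        rw [Multiset.sum_cons, Nat.cast_add, Nat.cast_succ]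
        omega
  rw [hunion, Set.ncard_union_eq ?_ (finite_boxIndex _ _ _) ((finite_boxIndex _ _ _).image _),
    Set.ncard_image_of_injective _ fun _ _ => (Multiset.cons_inj_right _).1]
  rw [Set.disjoint_left]
  rintro _ ⟨-, -, h3⟩ ⟨u, -, rfl⟩
  have := h3 (d + 1) (Multiset.mem_cons_self _ _)
  omega

theorem boxIndex_eq_empty {d n : ℕ} {w : ℤ} (hw : w < 0) : boxIndex d n w = ∅ := by
  refine Set.eq_empty_of_forall_notMem fun t ht => ?_
  have := ht.2.1
  omega

theorem coeff_qBinom (d n v : ℕ) :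
    (qBinom (n + d) d).coeff v = ((boxIndex d n v).ncard : ℤ) := by
  induction d generalizing n v with
  | zero =>
    rw [boxIndex_of_forall_eq_zero (Or.inl rfl)]
    rw [qBinom, Polynomial.coeff_one]
    split_ifs <;> simp_all
  | succ d ihd =>
    induction n generalizing v with
    | zero =>
      have h := ihd 0 v
      rw [zero_add] at h ⊢
      rw [qBinom, qBinom_eq_zero (Nat.lt_succ_self d), mul_zero, add_zero, h,
        boxIndex_of_forall_eq_zero (Or.inr rfl), boxIndex_of_forall_eq_zero (Or.inr rfl)]
    | succ n ihn =>
      have e1 : n + 1 + (d + 1) = n + 1 + d + 1 := by ring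
      have e2 : n + 1 + d = n + (d + 1) := by ring
      rw [e1, qBinom, Polynomial.coeff_add, ihd, e2, Polynomial.coeff_X_pow_mul',
        ncard_boxIndex_succ_succ]
      push_cast
      congr 1
      split_ifs with h
      · rw [ihn]
        push_cast [h]
        rfl
      · rw [boxIndex_eq_empty (by omega), Set.ncard_empty, Nat.cast_zero]

theorem coeff_one_sub_X_mul_qBinom (d n w : ℕ) :
    ((1 - Polynomial.X) * qBinom (n + d) d).coeff w =
      (Module.finrank ℚ (boxSpace d n w) : ℤ) - Module.finrank ℚ (boxSpace d n (w - 1)) := by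
  rw [finrank_boxSpace, finrank_boxSpace, sub_mul, one_mul, Polynomial.coeff_sub, coeff_qBinom]
  congr 1
  rcases w with _ | w
  · rw [boxIndex_eq_empty (by simp)]
    simp
  · rw [Polynomial.coeff_X_mul, coeff_qBinom]
    simp

/-- As `∑ m i ^ 2 ≥ m 0 * N`, twice `wt` is at most `N * (N - m 0)`. As there are at least two
parts, `2 * m 0 ≤ N`, so `2 * θ ≤ 2 * K * m 0 ≤ K * N`. The sum is at most `d * N`. -/
theorem two_mul_le_mul {N w d s : ℕ} (hs : 1 ≤ s) {m : Fin (s + 1) → ℕ}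
    (hm : IsDistinctPartition N s m) (hw : 1 + wt N m ≤ w) (hd : degBound N w m ≤ d) :
    2 * w ≤ d * N := by
  obtain ⟨K, hKd, hKθ⟩ := exists_degree_excess hm hw hd
  obtain ⟨hmono, hpos, hsum⟩ := hm
  have hwt := two_mul_wt_add m hsum
  have hsq : m 0 * N ≤ ∑ i, m i ^ 2 := by
    rw [← hsum, mul_sum]
    refine sum_le_sum fun i _ => ?_
    rw [sq]
    exact Nat.mul_le_mul_right _ (hmono.monotone (Fin.zero_le i))
  have h2 : 2 * m 0 ≤ N := by
    obtain ⟨r, rfl⟩ := Nat.exists_eq_add_of_le' hs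
    rw [← hsum, Fin.sum_univ_succ, Fin.sum_univ_succ]
    have := hmono (Fin.succ_pos (0 : Fin (r + 1)))
    omega
  obtain ⟨a, rfl⟩ := Nat.exists_eq_add_of_le (show m 0 ≤ N by omega)
  obtain ⟨θ, rfl⟩ := Nat.exists_eq_add_of_le (show wt (m 0 + a) m ≤ w by omega)
  simp only [Nat.add_sub_cancel_left] at hKd hKθ
  nlinarith [Nat.mul_le_mul_right (m 0 + a) hKd, Nat.mul_le_mul_left K h2]

end Count

end BinaryForm

end

theorem theorem3 (N : ℕ) (hN : 3 ≤ N) (k : Type*) [Field k]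
    (hk : ringChar k = 0 ∨ N < ringChar k)
    (s : ℕ) (hs : 1 ≤ s) (hsN : s ≤ BinaryForm.beta N - 1)
    (m : Fin (s + 1) → ℕ) (hm : BinaryForm.IsDistinctPartition N s m)
    (w : ℕ) (hw : 1 + BinaryForm.wt N m ≤ w)
    (d : ℕ) (hd : BinaryForm.degBound N w m ≤ d) :
    (∃ Q : Fin (BinaryForm.nu N w m) → MvPolynomial (Fin (N + 1)) k,
      LinearIndependent k Q ∧ ∀ i, BinaryForm.IsSemiInvariant d w (Q i)) ∧
    (BinaryForm.nu N w m : ℤ) ≤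
      ((1 - Polynomial.X) * BinaryForm.qBinom (N + d) d).coeff w := by
  constructor
  · obtain ⟨F, hF, h⟩ := BinaryForm.exists_linearIndependent_symmetric k hk hs hm hw hd
    exact BinaryForm.exists_linearIndependent_isSemiInvariant d w F hF (fun i => (h i).1)
      (fun i => (h i).2.1) (fun i => (h i).2.2.1) (fun i => (h i).2.2.2.1)
  -- The inequality does not involve `k`, so the construction is repeated over `ℚ`.
  · obtain ⟨F, hF, h⟩ := BinaryForm.exists_linearIndependent_symmetric ℚ
      (Or.inl (ringChar.eq ℚ 0)) hs hm hw hd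
    have hle := BinaryForm.card_add_finrank_boxSpace_le (d := d) (n := N) (w := w)
      (by exact_mod_cast BinaryForm.two_mul_le_mul hs hm hw hd)
      (BinaryForm.polarize N ∘ F) (BinaryForm.linearIndependent_polarize hF fun i => (h i).1)
      (fun i => BinaryForm.polarize_mem_boxSpace (h i).2.2.1 (h i).2.2.2.1) (fun i => by
        rw [Function.comp_apply, BinaryForm.lower_polarize,
          (h i).2.2.2.2 _ fun j => MvPolynomial.mkDerivation_X _ _ j, map_zero])
    rw [Fintype.card_fin] at hle
    rw [BinaryForm.coeff_one_sub_X_mul_qBinom]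
    omega
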